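/- Call a set $A\subset\mathbb R$ discrete closed if it has finitely many points in every bounded interval. There is a non-zero real, signed, locally finite Borel measure $\mu$ on $\mathbb R$ (in general of infinite total variation) with the following properties. The measure $\mu$ is pure point, $\mu=\sum_{\lambda\in\Lambda}\mu(\lambda)\,\delta_\lambda$ with $\mu(\lambda)\ne 0$ for all $\lambda\in\Lambda$; it is a temperate distribution; and its Fourier transform in the sense of distributions, defined by $\langle\hat\mu,\varphi\rangle=\langle\mu,\hat\varphi\rangle$ for Schwartz functions $\varphi$, where $\hat\varphi(t)=\int_{\mathbb R}\varphi(x)e^{-2\pi i t x}\,dx$, is also a (complex, locally finite) pure point measure, $\hat\mu=\sum_{s\in S}\hat\mu(s)\,\delta_s$ with $\hat\mu(s)\neq 0$ for all $s\in S$. Moreover: (i) the support $\Lambda$ and the spectrum $S$ are both discrete closed sets; (ii) $\Lambda$ contains only finitely many elements of any arithmetic progression $\{a+nd : n\in\mathbb Z\}$, $a,d\in\mathbb R$. In particular, $\Lambda$ is not contained in any finite union of translates of an arithmetic progression. (Every pure point measure which has a pure point Fourier transform, and whose support and spectrum are both uniformly discrete, does have its support contained in such a union, by an earlier theorem of the authors;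 so uniform discreteness cannot be relaxed to discreteness there.) -/

import Mathlib

open MeasureTheory SchwartzMap FourierTransform

/-- A complex, locally finite (possibly infinite) Borel measure on `ℝ`, given by its polar
decomposition `μ = u · |μ|`: the total variation `|μ|` is a locally finite positive measure,
and `u` is a measurable function of modulus one. -/
structure LocFinComplexMeasure where
  /-- The total variation measure `|μ|`. -/
  variation : Measure ℝ
  /-- The total variation is finite on a neighbourhood of every point. -/
  locFin : IsLocallyFiniteMeasure variation
  /-- The phase `u = dμ / d|μ|`. -/
  phase : ℝ → ℂ
  /-- The phase is measurable. -/
  measurable_phase : Measurable phase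
  /-- The phase has modulus one. -/
  norm_phase : ∀ x, ‖phase x‖ = 1

namespace LocFinComplexMeasure

/-- The integral `∫ f dμ`. -/
noncomputable def integral (μ : LocFinComplexMeasure) (f : ℝ → ℂ) : ℂ :=
  ∫ x, f x * μ.phase x ∂μ.variation

/-- The value `μ(E)`, for a bounded Borel set `E`. -/
noncomputable def value (μ : LocFinComplexMeasure) (E : Set ℝ) : ℂ :=
  ∫ x in E, μ.phase x ∂μ.variation

/-- `μ` is a real (signed) measure: `μ(E)` is real for every bounded Borel set `E`. -/
def IsReal (μ : LocFinComplexMeasure) : Prop :=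
  ∀ E : Set ℝ, MeasurableSet E → Bornology.IsBounded E → (μ.value E).im = 0

/-- The support of a pure point measure: the set of its non-zero atoms. -/
def atoms (μ : LocFinComplexMeasure) : Set ℝ :=
  {x | μ.value {x} ≠ 0}

/-- `μ` is a pure point measure, `μ = ∑_{x ∈ Λ} μ({x}) δ_x` with `Λ` the set of its atoms:
`Λ` is countable and `|μ|` does not charge the complement of `Λ`. -/
def IsPurePoint (μ : LocFinComplexMeasure) : Prop :=
  μ.atoms.Countable ∧ μ.variation μ.atomsᶜ = 0

/-- The temperate distribution `T` is the measure `μ`: they agree on compactly supported smooth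
functions. (These are dense in the Schwartz space, so `μ` determines `T`.) -/
def IsDistribution (μ : LocFinComplexMeasure) (T : 𝓢'(ℝ, ℂ)) : Prop :=
  ∀ f : 𝓢(ℝ, ℂ), HasCompactSupport f → T f = μ.integral f

end LocFinComplexMeasure

/-- A discrete closed subset of `ℝ`: it has finitely many points in every bounded interval. -/
def IsDiscreteClosed (A : Set ℝ) : Prop :=
  ∀ a b : ℝ, (A ∩ Set.Icc a b).Finite

/-- The (two-sided) arithmetic progression `{a + n d : n ∈ ℤ}`. -/
def arithProg (a d : ℝ) : Set ℝ :=
  Set.range fun n : ℤ => a + n * d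

/-! The function `Θ(x) = e(√2 x) (2 e(x) - 1) / (2 - e(x))`, with `e(x) = exp (2πix)`, has modulus
one on the line and equals `e(ψ(x))` for an increasing analytic bijection `ψ` (`innerPhase`). The
measure has atoms where `ψ(x) ∈ c + ℤ`, with weights `1 / ψ'(x)`.

The change of variables `y = ψ(x)` turns its pairing with `𝓕 φ` into a sum over `c + ℤ`. Poisson
summation makes this a sum over `n` of `e(nc) ∫ 𝓕 φ · Θ⁻ⁿ` (`tsum_fourier_invPhase`). On the unit
circle `(2w - 1) / (2 - w)` is an absolutely convergent power series in `w`, so `Θ⁻ⁿ` is an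
absolutely convergent sum of characters of frequencies `-(n√2 + k)`, with `k ≥ 0` if `n ≥ 0` and `k
≤ 0` if `n ≤ 0` (`exists_fourierSeries_innerPhase`). The common sign keeps the spectrum discrete,
although `ℤ√2 + ℤ` is dense.

Three points of a progression have a rational ratio of differences. For each choice of indices and
ratio, this is an analytic equation in `c`. It is not an identity, by a maximum principle
(`eq_of_periodic_of_meanValue`), so it holds for countably many `c` only. Any other `c` leaves at
most two atoms in each progression. -/

namespace LocFinComplexMeasure

/-! ### Pure point measures with prescribed atoms -/

section OfAtoms

variable {ι : Type*} [Countable ι] (x : ι → ℝ) (w : ι → ℂ)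

/-- The total variation of `∑ i, w i • δ_{x i}`, for distinct points `x i`. -/
noncomputable def atomsVariation : Measure ℝ :=
  Measure.sum fun i => ENNReal.ofReal ‖w i‖ • Measure.dirac (x i)

/-- The phase of `∑ i, w i • δ_{x i}`, for distinct points `x i`. -/
noncomputable def atomsPhase : ℝ → ℂ :=
  -- The value 1 at zero weights and off the points keeps the modulus equal to one everywhere.
  Function.extend x (fun i => if w i = 0 then 1 else w i / ‖w i‖) 1

variable {x w}

omit [Countable ι] in
theorem atomsVariation_apply {s : Set ℝ} (hs : MeasurableSet s) :
    atomsVariation x w s = ∑' i, ENNReal.ofReal ‖w i‖ * s.indicator 1 (x i) := by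
  simp [atomsVariation, Measure.sum_apply _ hs, hs]

omit [Countable ι] in
theorem isLocallyFiniteMeasure_atomsVariation
    (hfin : ∀ a b : ℝ, {i | w i ≠ 0 ∧ x i ∈ Set.Icc a b}.Finite) :
    IsLocallyFiniteMeasure (atomsVariation x w) := by
  refine ⟨fun t => ⟨Set.Icc (t - 1) (t + 1), Icc_mem_nhds (by linarith) (by linarith), ?_⟩⟩
  rw [atomsVariation_apply measurableSet_Icc,
    tsum_eq_sum (s := (hfin (t - 1) (t + 1)).toFinset) ?_]
  · refine ENNReal.sum_lt_top.2 fun i _ => ENNReal.mul_lt_top ENNReal.ofReal_lt_top ?_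
    by_cases h : x i ∈ Set.Icc (t - 1) (t + 1) <;> simp [h]
  · intro i hi
    by_cases h : x i ∈ Set.Icc (t - 1) (t + 1)
    · have : w i = 0 := by
        by_contra hw
        exact hi ((Set.Finite.mem_toFinset _).2 ⟨hw, h⟩)
      simp [this]
    · simp [h]

/-- The phase differs from the constant 1 only on the countable range of `x`. -/
theorem measurable_atomsPhase : Measurable (atomsPhase x w) := by
  refine (measurable_const (a := (1 : ℂ))).measurable_of_countable_ne
    ((Set.countable_range x).mono fun t ht => ?_)
  by_contra hr
  exact ht (by rw [atomsPhase, Function.extend_apply' _ _ _ (by simpa using hr)]; rfl)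

omit [Countable ι] in
theorem norm_atomsPhase (t : ℝ) : ‖atomsPhase x w t‖ = 1 := by
  classical
  rw [atomsPhase, Function.extend_def]
  split_ifs with h h' <;> simp [*]

variable (x w) in
/-- The measure `∑ i, w i • δ_{x i}`, for distinct points `x i` such that only finitely many of them
with `w i ≠ 0` lie in any bounded interval. -/
noncomputable def ofAtoms (hfin : ∀ a b : ℝ, {i | w i ≠ 0 ∧ x i ∈ Set.Icc a b}.Finite) :
    LocFinComplexMeasure where
  variation := atomsVariation x w
  locFin := isLocallyFiniteMeasure_atomsVariation hfin
  phase := atomsPhase x w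
  measurable_phase := measurable_atomsPhase
  norm_phase := norm_atomsPhase

omit [Countable ι] in
theorem norm_mul_atomsPhase (hx : Function.Injective x) (i : ι) :
    (‖w i‖ : ℂ) * atomsPhase x w (x i) = w i := by
  rw [atomsPhase, hx.extend_apply]
  split_ifs with h
  · simp [h]
  · rw [mul_div_cancel₀]
    simpa using h

variable (hx : Function.Injective x)
  (hfin : ∀ a b : ℝ, {i | w i ≠ 0 ∧ x i ∈ Set.Icc a b}.Finite)

include hx in
theorem integral_ofAtoms_of_integrable {f : ℝ → ℂ} (hf : Integrable f (atomsVariation x w)) :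
    (ofAtoms x w hfin).integral f = ∑' i, f (x i) * w i := by
  have hint : Integrable (fun t => f t * atomsPhase x w t) (atomsVariation x w) :=
    hf.mul_bdd (c := 1) measurable_atomsPhase.aestronglyMeasurable
      (Filter.Eventually.of_forall fun t => (norm_atomsPhase t).le)
  change ∫ t, f t * atomsPhase x w t ∂(atomsVariation x w) = _
  rw [atomsVariation] at hint ⊢
  rw [integral_sum_measure hint]
  refine tsum_congr fun i => ?_
  rw [integral_smul_measure, integral_dirac, ENNReal.toReal_ofReal (norm_nonneg _),
    Complex.real_smul]
  linear_combination f (x i) * norm_mul_atomsPhase (w := w) hx i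

include hx in
theorem integral_ofAtoms {f : ℝ → ℂ} (hf : Continuous f) (hc : HasCompactSupport f) :
    (ofAtoms x w hfin).integral f = ∑' i, f (x i) * w i := by
  have := isLocallyFiniteMeasure_atomsVariation hfin
  exact integral_ofAtoms_of_integrable hx hfin (hf.integrable_of_hasCompactSupport hc)

include hx in
theorem variation_singleton_ofAtoms (i : ι) :
    (ofAtoms x w hfin).variation {x i} = ENNReal.ofReal ‖w i‖ := by
  change atomsVariation x w _ = _
  rw [atomsVariation_apply (measurableSet_singleton _), tsum_eq_single i]
  · simp
  · intro j hj
    simp [hx.ne hj]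

theorem variation_singleton_ofAtoms_of_notMem {t : ℝ} (ht : t ∉ Set.range x) :
    (ofAtoms x w hfin).variation {t} = 0 := by
  change atomsVariation x w _ = _
  rw [atomsVariation_apply (measurableSet_singleton _)]
  simp only [ENNReal.tsum_eq_zero]
  intro i
  have : x i ≠ t := fun h => ht ⟨i, h⟩
  simp [this]

include hx in
theorem atoms_ofAtoms : (ofAtoms x w hfin).atoms = x '' {i | w i ≠ 0} := by
  ext t
  simp only [atoms, value, Set.mem_ofPred_eq, integral_singleton, Measure.real]
  by_cases ht : t ∈ Set.range x
  · obtain ⟨i, rfl⟩ := ht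
    rw [variation_singleton_ofAtoms hx hfin, ENNReal.toReal_ofReal (norm_nonneg _),
      Complex.real_smul, hx.mem_set_image]
    exact not_congr (Eq.congr_left (norm_mul_atomsPhase (w := w) hx i))
  · rw [variation_singleton_ofAtoms_of_notMem hfin ht]
    simp only [ENNReal.toReal_zero, zero_smul, ne_eq, not_true_eq_false, false_iff]
    rintro ⟨i, -, rfl⟩
    exact ht ⟨i, rfl⟩

include hx in
theorem isPurePoint_ofAtoms : (ofAtoms x w hfin).IsPurePoint := by
  have hc : (ofAtoms x w hfin).atoms.Countable := by
    rw [atoms_ofAtoms hx hfin]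
    exact (Set.to_countable _).image _
  refine ⟨hc, ?_⟩
  change atomsVariation x w _ = _
  rw [atomsVariation_apply hc.measurableSet.compl]
  simp only [ENNReal.tsum_eq_zero]
  intro i
  by_cases h : w i = 0
  · simp [h]
  · have : x i ∈ (ofAtoms x w hfin).atoms := by
      rw [atoms_ofAtoms hx hfin]
      exact ⟨i, h, rfl⟩
    simp [this]

include hx in
theorem isDiscreteClosed_atoms_ofAtoms : IsDiscreteClosed (ofAtoms x w hfin).atoms := by
  intro a b
  rw [atoms_ofAtoms hx hfin]
  refine ((hfin a b).image x).subset ?_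
  rintro _ ⟨⟨i, hi, rfl⟩, h⟩
  exact ⟨i, ⟨hi, h⟩, rfl⟩

end OfAtoms

end LocFinComplexMeasure

/-! ### The phase and its inverse -/

/-- The phase function of the inner function `e(√2 x) (2 e(x) - 1) / (2 - e(x))`, where
`e(x) = exp (2 π i x)`. -/
noncomputable def innerPhase (x : ℝ) : ℝ :=
  (√2 + 1) * x + Real.arctan (Real.sin (2 * Real.pi * x) / (2 - Real.cos (2 * Real.pi * x))) /
    Real.pi

/-- The derivative of `innerPhase`. -/
noncomputable def innerPhaseDeriv (x : ℝ) : ℝ :=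
  √2 + 3 / (5 - 4 * Real.cos (2 * Real.pi * x))

/-- The term `3 / (5 - 4 cos)` is the Poisson kernel at radius 1/2, as expected for the Blaschke
factor with zero 1/2. -/
theorem hasDerivAt_innerPhase (x : ℝ) : HasDerivAt innerPhase (innerPhaseDeriv x) x := by
  have hc := Real.cos_le_one (2 * Real.pi * x)
  have h2 : 2 - Real.cos (2 * Real.pi * x) ≠ 0 := by linarith
  have h5 : 5 - 4 * Real.cos (2 * Real.pi * x) ≠ 0 := by linarith
  have hl : HasDerivAt (fun x : ℝ => 2 * Real.pi * x) (2 * Real.pi) x := by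
    simpa using (hasDerivAt_id x).const_mul (2 * Real.pi)
  have h := ((hasDerivAt_id x).const_mul (√2 + 1)).add
    (((hl.sin.div (hl.cos.const_sub 2) h2).arctan).div_const Real.pi)
  refine HasDerivAt.congr_deriv (f' := _) h ?_
  rw [innerPhaseDeriv]
  have hsc := Real.sin_sq_add_cos_sq (2 * Real.pi * x)
  simp only [Pi.div_apply]
  set c := Real.cos (2 * Real.pi * x)
  set s := Real.sin (2 * Real.pi * x)
  have h1 : 1 + (s / (2 - c)) ^ 2 = (5 - 4 * c) / (2 - c) ^ 2 := by
    field_simp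
    linear_combination hsc
  rw [h1]
  field_simp
  linear_combination (-2 : ℝ) * hsc

theorem innerPhaseDeriv_pos (x : ℝ) : 0 < innerPhaseDeriv x := by
  have hc := Real.cos_le_one (2 * Real.pi * x)
  have : 0 < 5 - 4 * Real.cos (2 * Real.pi * x) := by linarith
  unfold innerPhaseDeriv
  positivity

theorem innerPhaseDeriv_ge_one (x : ℝ) : 1 ≤ innerPhaseDeriv x := by
  have hc := Real.cos_le_one (2 * Real.pi * x)
  have h5 : 0 < 5 - 4 * Real.cos (2 * Real.pi * x) := by linarith
  have h1 : 1 ≤ √2 := Real.one_le_sqrt.2 (by norm_num)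
  have : 0 ≤ 3 / (5 - 4 * Real.cos (2 * Real.pi * x)) := by positivity
  unfold innerPhaseDeriv
  linarith

/-- Here `⊤` means real analytic, not merely smooth; the genericity argument for `c` needs this. -/
theorem contDiff_innerPhase : ContDiff ℝ ⊤ innerPhase := by
  unfold innerPhase
  have h2 : ∀ x : ℝ, 2 - Real.cos (2 * Real.pi * x) ≠ 0 := fun x => by
    linarith [Real.cos_le_one (2 * Real.pi * x)]
  have hl : ContDiff ℝ ⊤ (fun x : ℝ => 2 * Real.pi * x) := by fun_prop
  exact (contDiff_const.mul contDiff_id).add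
    ((Real.contDiff_arctan.comp ((Real.contDiff_sin.comp hl).div
      (contDiff_const.sub (Real.contDiff_cos.comp hl)) h2)).div_const _)

theorem strictMono_innerPhase : StrictMono innerPhase :=
  strictMono_of_hasDerivAt_pos hasDerivAt_innerPhase innerPhaseDeriv_pos

theorem abs_innerPhase_sub_le (x : ℝ) : |innerPhase x - (√2 + 1) * x| ≤ 1 := by
  have hpi := Real.pi_pos
  rw [innerPhase, add_sub_cancel_left, abs_div, abs_of_pos hpi, div_le_one hpi, abs_le]
  constructor
  · linarith [Real.neg_pi_div_two_lt_arctan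
      (Real.sin (2 * Real.pi * x) / (2 - Real.cos (2 * Real.pi * x)))]
  · linarith [Real.arctan_lt_pi_div_two
      (Real.sin (2 * Real.pi * x) / (2 - Real.cos (2 * Real.pi * x)))]

theorem surjective_innerPhase : Function.Surjective innerPhase := by
  have hp : (0 : ℝ) < √2 + 1 := by positivity
  refine contDiff_innerPhase.continuous.surjective ?_ ?_
  · refine Filter.tendsto_atTop_mono (fun x => ?_)
      (Filter.tendsto_atTop_add_const_right _ (-1) (Filter.tendsto_id.const_mul_atTop hp))
    have := (abs_le.1 (abs_innerPhase_sub_le x)).1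
    simp only [id]
    linarith
  · refine Filter.tendsto_atBot_mono (fun x => ?_)
      (Filter.tendsto_atBot_add_const_right _ 1 (Filter.tendsto_id.const_mul_atBot hp))
    have := (abs_le.1 (abs_innerPhase_sub_le x)).2
    simp only [id]
    linarith

/-- `innerPhase` as a homeomorphism of the line. -/
noncomputable def innerPhaseHomeo : ℝ ≃ₜ ℝ :=
  (strictMono_innerPhase.orderIsoOfSurjective innerPhase surjective_innerPhase).toHomeomorph

/-- The inverse of `innerPhase`. -/
noncomputable def invPhase (y : ℝ) : ℝ := innerPhaseHomeo.symm y

theorem innerPhase_invPhase (y : ℝ) : innerPhase (invPhase y) = y :=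
  innerPhaseHomeo.apply_symm_apply y

theorem invPhase_innerPhase (x : ℝ) : invPhase (innerPhase x) = x :=
  innerPhaseHomeo.symm_apply_apply x

theorem contDiff_invPhase : ContDiff ℝ ⊤ invPhase :=
  innerPhaseHomeo.contDiff_symm_deriv (fun x => (innerPhaseDeriv_pos x).ne')
    hasDerivAt_innerPhase contDiff_innerPhase

theorem continuous_invPhase : Continuous invPhase := contDiff_invPhase.continuous

theorem strictMono_invPhase : StrictMono invPhase := fun a b h => by
  rwa [← strictMono_innerPhase.lt_iff_lt, innerPhase_invPhase, innerPhase_invPhase]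

theorem hasDerivAt_invPhase (y : ℝ) :
    HasDerivAt invPhase (innerPhaseDeriv (invPhase y))⁻¹ y :=
  HasDerivAt.of_local_left_inverse continuous_invPhase.continuousAt
    (hasDerivAt_innerPhase _) (innerPhaseDeriv_pos _).ne'
    (Filter.Eventually.of_forall innerPhase_invPhase)

theorem innerPhase_add_one (x : ℝ) : innerPhase (x + 1) = innerPhase x + (√2 + 1) := by
  have h : 2 * Real.pi * (x + 1) = 2 * Real.pi * x + 2 * Real.pi := by ring
  simp only [innerPhase, h, Real.sin_add_two_pi, Real.cos_add_two_pi]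
  ring

theorem invPhase_add (y : ℝ) : invPhase (y + (√2 + 1)) = invPhase y + 1 := by
  rw [← strictMono_innerPhase.injective.eq_iff, innerPhase_invPhase, innerPhase_add_one,
    innerPhase_invPhase]

theorem abs_le_abs_invPhase (y : ℝ) : |y| ≤ 3 * |invPhase y| + 1 := by
  have h := abs_innerPhase_sub_le (invPhase y)
  rw [innerPhase_invPhase] at h
  have h2 : √2 ≤ 2 := by rw [Real.sqrt_le_left (by norm_num)]; norm_num
  calc |y| = |(y - (√2 + 1) * invPhase y) + (√2 + 1) * invPhase y| := by ring_nf
    _ ≤ 1 + |(√2 + 1) * invPhase y| := (abs_add_le _ _).trans (by linarith)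
    _ = 1 + (√2 + 1) * |invPhase y| := by rw [abs_mul, abs_of_pos (by positivity : 0 < √2 + 1)]
    _ ≤ 1 + 3 * |invPhase y| := by gcongr; linarith
    _ = _ := by ring

/-! ### Characters and the inner function -/

theorem exp_two_mul_arctan (t : ℝ) :
    Complex.exp (2 * (Real.arctan t : ℂ) * Complex.I) =
      (1 + t * Complex.I) / (1 - t * Complex.I) := by
  have h1 : (0 : ℝ) < 1 + t ^ 2 := by positivity
  have hs : ((√(1 + t ^ 2) : ℝ) : ℂ) ^ 2 = 1 + (t : ℂ) ^ 2 := by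
    exact_mod_cast Real.sq_sqrt h1.le
  have hs0 : ((√(1 + t ^ 2) : ℝ) : ℂ) ≠ 0 := by
    exact_mod_cast (Real.sqrt_pos.2 h1).ne'
  have h0 : 1 - (t : ℂ) * Complex.I ≠ 0 := fun h => by simpa using congrArg Complex.re h
  have : 2 * (Real.arctan t : ℂ) * Complex.I = ((2 : ℕ) : ℂ) * ((Real.arctan t : ℝ) * Complex.I) := by
    push_cast; ring
  rw [this, Complex.exp_nat_mul, Complex.exp_ofReal_mul_I, Real.cos_arctan, Real.sin_arctan]
  push_cast
  rw [eq_div_iff h0, div_add' _ _ _ hs0, div_pow, hs]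
  have h10 : 1 + (t : ℂ) ^ 2 ≠ 0 := by exact_mod_cast h1.ne'
  field_simp
  linear_combination (-(t : ℂ) ^ 2 * (1 + t * Complex.I)) * Complex.I_sq

/-- The character `x ↦ exp (2 π i x)`. -/
noncomputable def cexpChar (x : ℝ) : ℂ := Complex.exp (2 * Real.pi * x * Complex.I)

theorem cexpChar_add (x y : ℝ) : cexpChar (x + y) = cexpChar x * cexpChar y := by
  rw [cexpChar, cexpChar, cexpChar, ← Complex.exp_add]
  push_cast; ring_nf

theorem cexpChar_neg (x : ℝ) : cexpChar (-x) = (cexpChar x)⁻¹ := by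
  rw [cexpChar, cexpChar, ← Complex.exp_neg]
  push_cast; ring_nf

theorem cexpChar_nat_mul (n : ℕ) (x : ℝ) : cexpChar (n * x) = cexpChar x ^ n := by
  rw [cexpChar, cexpChar, ← Complex.exp_nat_mul]
  push_cast; ring_nf

theorem norm_cexpChar (x : ℝ) : ‖cexpChar x‖ = 1 := by
  rw [cexpChar]
  exact_mod_cast Complex.norm_exp_ofReal_mul_I (2 * Real.pi * x)

theorem continuous_cexpChar : Continuous cexpChar := by
  unfold cexpChar
  fun_prop

theorem conj_cexpChar (x : ℝ) : (starRingEnd ℂ) (cexpChar x) = cexpChar (-x) := by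
  rw [cexpChar_neg, Complex.inv_def, Complex.normSq_eq_norm_sq, norm_cexpChar]
  simp

/-- On the unit circle `(2w - 1) / (2 - w) = w (2 - w̄) / (2 - w)`, and `2 - w̄` has argument
`arctan (sin / (2 - cos))`, which the quotient doubles. -/
theorem cexpChar_innerPhase (x : ℝ) :
    cexpChar (innerPhase x) =
      cexpChar (√2 * x) * ((2 * cexpChar x - 1) / (2 - cexpChar x)) := by
  have hpi : (Real.pi : ℂ) ≠ 0 := by exact_mod_cast Real.pi_ne_zero
  have hw : cexpChar x = (Real.cos (2 * Real.pi * x) : ℂ) +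
      Real.sin (2 * Real.pi * x) * Complex.I := by
    rw [cexpChar, ← Complex.exp_ofReal_mul_I]
    push_cast; ring_nf
  have hsc : (Real.sin (2 * Real.pi * x) : ℂ) ^ 2 + (Real.cos (2 * Real.pi * x) : ℂ) ^ 2 = 1 := by
    exact_mod_cast Real.sin_sq_add_cos_sq (2 * Real.pi * x)
  have hc : (2 : ℂ) - Real.cos (2 * Real.pi * x) ≠ 0 := by
    have : 2 - Real.cos (2 * Real.pi * x) ≠ 0 := by linarith [Real.cos_le_one (2 * Real.pi * x)]
    exact_mod_cast this
  have hd : (2 : ℂ) - cexpChar x ≠ 0 := fun h => by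
    have h' := congrArg norm (sub_eq_zero.1 h)
    rw [norm_cexpChar] at h'
    norm_num at h'
  have hsplit : cexpChar (innerPhase x) = cexpChar (√2 * x) * (cexpChar x *
      Complex.exp (2 * (Real.arctan (Real.sin (2 * Real.pi * x) /
        (2 - Real.cos (2 * Real.pi * x))) : ℂ) * Complex.I)) := by
    simp only [cexpChar, ← Complex.exp_add, innerPhase]
    congr 1
    push_cast
    field_simp
    ring
  rw [hsplit, exp_two_mul_arctan]
  congr 1
  rw [hw] at hd ⊢
  push_cast at *
  set c : ℂ := Complex.cos (2 * Real.pi * x)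
  set s : ℂ := Complex.sin (2 * Real.pi * x)
  have hd' : 2 - c - s * Complex.I ≠ 0 := by rwa [sub_sub]
  have e1 : (1 + s / (2 - c) * Complex.I) / (1 - s / (2 - c) * Complex.I) =
      (2 - c + s * Complex.I) / (2 - c - s * Complex.I) := by
    rw [← mul_div_mul_left _ _ hc]
    congr 1 <;> field_simp
  rw [e1, ← sub_sub, mul_div_assoc']
  congr 1
  linear_combination s ^ 2 * Complex.I_sq - hsc

/-! ### Fourier series of the powers of the inner function -/

/-- `F` is given on the unit circle by an absolutely convergent power series. -/
def HasAbsPowerSeries (F : ℂ → ℂ) : Prop :=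
  ∃ c : ℕ → ℂ, Summable (fun k => ‖c k‖) ∧ ∀ w : ℂ, ‖w‖ = 1 → F w = ∑' k, c k * w ^ k

namespace HasAbsPowerSeries

theorem mul {F H : ℂ → ℂ} (hF : HasAbsPowerSeries F) (hH : HasAbsPowerSeries H) :
    HasAbsPowerSeries (fun w => F w * H w) := by
  obtain ⟨c, hc, hF⟩ := hF
  obtain ⟨d, hd, hH⟩ := hH
  refine ⟨fun n => ∑ kl ∈ Finset.HasAntidiagonal.antidiagonal n, c kl.1 * d kl.2,
    summable_norm_sum_mul_antidiagonal_of_summable_norm hc hd, fun w hw => ?_⟩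
  beta_reduce
  rw [hF w hw, hH w hw, tsum_mul_tsum_eq_tsum_sum_antidiagonal_of_summable_norm
    (by simpa [hw] using hc) (by simpa [hw] using hd)]
  refine tsum_congr fun n => ?_
  rw [Finset.sum_mul]
  refine Finset.sum_congr rfl fun kl hkl => ?_
  rw [← Finset.HasAntidiagonal.mem_antidiagonal.1 hkl, pow_add]
  ring

theorem one : HasAbsPowerSeries (fun _ => 1) := by
  refine ⟨Pi.single 0 1, ?_, fun w _ => ?_⟩
  · refine summable_of_ne_finset_zero (s := {0}) fun k hk => ?_
    simp_all
  · rw [tsum_eq_single 0 (fun k hk => by simp [hk])]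
    simp

theorem pow {F : ℂ → ℂ} (hF : HasAbsPowerSeries F) (n : ℕ) :
    HasAbsPowerSeries (fun w => F w ^ n) := by
  induction n with
  | zero => simpa using one
  | succ n ih => simpa only [pow_succ] using ih.mul hF

theorem two_mul_sub_one : HasAbsPowerSeries (fun w => 2 * w - 1) := by
  refine ⟨fun k => if k = 0 then -1 else if k = 1 then 2 else 0, ?_, fun w _ => ?_⟩
  · refine summable_of_ne_finset_zero (s := {0, 1}) fun k hk => ?_
    simp_all
  · rw [tsum_eq_sum (s := {0, 1}) (fun k hk => by simp_all)]
    simp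
    ring

theorem inv_two_sub : HasAbsPowerSeries (fun w => (2 - w)⁻¹) := by
  refine ⟨fun k => (1 / 2) ^ (k + 1), ?_, fun w hw => ?_⟩
  · have h : Summable fun k : ℕ => (1 / 2 : ℝ) ^ (k + 1) :=
      (summable_nat_add_iff 1).2 summable_geometric_two
    simpa using h
  · have h2 : (2 : ℂ) - w ≠ 0 := fun h => by
      have h' := congrArg norm (sub_eq_zero.1 h)
      rw [hw] at h'
      norm_num at h'
    have h1 : (1 : ℂ) - w / 2 ≠ 0 := fun h => h2 (by linear_combination 2 * h)
    have hk : ∀ k : ℕ, ((1 : ℂ) / 2) ^ (k + 1) * w ^ k = 1 / 2 * (w / 2) ^ k := fun k => by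
      rw [div_pow w, pow_succ, div_pow 1]
      ring
    simp only [hk, tsum_mul_left]
    rw [tsum_geometric_of_norm_lt_one (by rw [norm_div, hw]; norm_num)]
    field_simp

theorem blaschke : HasAbsPowerSeries (fun w => (2 * w - 1) / (2 - w)) := by
  simpa only [div_eq_mul_inv] using two_mul_sub_one.mul inv_two_sub

end HasAbsPowerSeries

theorem cexpChar_nat_mul_innerPhase (m : ℕ) (x : ℝ) :
    cexpChar (m * innerPhase x) =
      cexpChar (m * (√2 * x)) * ((2 * cexpChar x - 1) / (2 - cexpChar x)) ^ m := by
  rw [cexpChar_nat_mul, cexpChar_innerPhase, mul_pow, cexpChar_nat_mul]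

/-- Only `k` of the same sign as `n` occur, whence `|n√2 + k| = |n|√2 + |k|`. This inequality makes
the spectrum discrete. -/
theorem exists_fourierSeries_innerPhase (n : ℤ) :
    ∃ C : ℤ → ℂ, Summable (fun k => ‖C k‖) ∧
      (∀ k, C k ≠ 0 → |(n : ℝ)| + |(k : ℝ)| ≤ |n * √2 + k|) ∧
      ∀ x : ℝ, cexpChar (-(n * innerPhase x)) = ∑' k, C k * cexpChar (-((n * √2 + k) * x)) := by
  have h1 : 1 ≤ √2 := Real.one_le_sqrt.2 (by norm_num)
  obtain ⟨m, rfl | rfl⟩ := n.eq_nat_or_neg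
  · obtain ⟨c, hc, hF⟩ := HasAbsPowerSeries.blaschke.pow m
    beta_reduce at hF
    have hi : Function.Injective ((↑) : ℕ → ℤ) := Nat.cast_injective
    have he : ∀ k ∉ Set.range ((↑) : ℕ → ℤ), Function.extend ((↑) : ℕ → ℤ) c (0 : ℤ → ℂ) k = 0 := fun k hk =>
      Function.extend_apply' c (0 : ℤ → ℂ) k hk
    refine ⟨Function.extend ((↑) : ℕ → ℤ) c 0, ?_, fun k hk => ?_, fun x => ?_⟩
    · rw [← Function.Injective.summable_iff hi]
      · simpa [Function.comp_def, hi.extend_apply] using hc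
      · intro k hk
        simp [he k hk]
    · by_cases hr : k ∈ Set.range ((↑) : ℕ → ℤ)
      · obtain ⟨j, rfl⟩ := hr
        push_cast
        rw [Nat.abs_cast, Nat.abs_cast, abs_of_nonneg (by positivity)]
        nlinarith [(Nat.cast_nonneg m : (0 : ℝ) ≤ m)]
      · exact absurd (he k hr) hk
    -- The power series has nonnegative powers, so for `n ≥ 0` it is applied at `e(-x)`, the
    -- conjugate of `e(x)`.
    · have hd : (2 * cexpChar (-x) - 1) / (2 - cexpChar (-x)) =
          (starRingEnd ℂ) ((2 * cexpChar x - 1) / (2 - cexpChar x)) := by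
        simp [conj_cexpChar, Complex.conj_ofNat]
      rw [← hi.tsum_eq]
      · simp only [hi.extend_apply]
        push_cast
        rw [← conj_cexpChar, cexpChar_nat_mul_innerPhase, map_mul, map_pow, ← hd,
          hF _ (norm_cexpChar _), ← tsum_mul_left, conj_cexpChar]
        refine tsum_congr fun k => ?_
        rw [← cexpChar_nat_mul, mul_left_comm, ← cexpChar_add]
        congr 2
        ring
      · intro k hk
        by_contra hr
        simp [he k hr] at hk
  · obtain ⟨c, hc, hF⟩ := HasAbsPowerSeries.blaschke.pow m
    beta_reduce at hF
    have hi : Function.Injective (fun j : ℕ => -(j : ℤ)) :=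
      neg_injective.comp Nat.cast_injective
    have he : ∀ k ∉ Set.range (fun j : ℕ => -(j : ℤ)), Function.extend (fun j : ℕ => -(j : ℤ)) c (0 : ℤ → ℂ) k = 0 := fun k hk =>
      Function.extend_apply' c (0 : ℤ → ℂ) k hk
    refine ⟨Function.extend (fun j : ℕ => -(j : ℤ)) c 0, ?_, fun k hk => ?_, fun x => ?_⟩
    · rw [← Function.Injective.summable_iff hi]
      · simpa [Function.comp_def, hi.extend_apply] using hc
      · intro k hk
        simp [he k hk]
    · by_cases hr : k ∈ Set.range (fun j : ℕ => -(j : ℤ))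
      · obtain ⟨j, rfl⟩ := hr
        push_cast
        rw [abs_neg, abs_neg, neg_mul, ← neg_add, abs_neg, Nat.abs_cast, Nat.abs_cast,
          abs_of_nonneg (by positivity)]
        nlinarith [(Nat.cast_nonneg m : (0 : ℝ) ≤ m)]
      · exact absurd (he k hr) hk
    · rw [← hi.tsum_eq]
      · simp only [hi.extend_apply]
        push_cast
        rw [neg_mul, neg_neg, cexpChar_nat_mul_innerPhase, hF _ (norm_cexpChar _),
          ← tsum_mul_left]
        refine tsum_congr fun k => ?_
        rw [← cexpChar_nat_mul, mul_left_comm, ← cexpChar_add]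
        congr 2
        ring
      · intro k hk
        by_contra hr
        simp [he k hr] at hk

/-- The coefficients of the Fourier series of `exp (-2 π i n innerPhase)`. -/
noncomputable def phaseCoeff (n k : ℤ) : ℂ := (exists_fourierSeries_innerPhase n).choose k

theorem summable_norm_phaseCoeff (n : ℤ) : Summable (fun k => ‖phaseCoeff n k‖) :=
  (exists_fourierSeries_innerPhase n).choose_spec.1

theorem abs_add_abs_le_of_phaseCoeff_ne_zero {n k : ℤ} (h : phaseCoeff n k ≠ 0) :
    |(n : ℝ)| + |(k : ℝ)| ≤ |n * √2 + k| :=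
  (exists_fourierSeries_innerPhase n).choose_spec.2.1 k h

theorem cexpChar_neg_int_mul_innerPhase (n : ℤ) (x : ℝ) :
    cexpChar (-(n * innerPhase x)) =
      ∑' k, phaseCoeff n k * cexpChar (-((n * √2 + k) * x)) :=
  (exists_fourierSeries_innerPhase n).choose_spec.2.2 x

theorem finite_int_prod_abs_le (R : ℝ) :
    {p : ℤ × ℤ | |(p.1 : ℝ)| + |(p.2 : ℝ)| ≤ R}.Finite := by
  refine ((Set.finite_Icc (-⌈R⌉) ⌈R⌉).prod (Set.finite_Icc (-⌈R⌉) ⌈R⌉)).subset ?_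
  rintro ⟨n, k⟩ h
  simp only [Set.mem_ofPred_eq] at h
  have hn : |(n : ℝ)| ≤ (⌈R⌉ : ℤ) := by linarith [Int.le_ceil R, abs_nonneg (k : ℝ)]
  have hk : |(k : ℝ)| ≤ (⌈R⌉ : ℤ) := by linarith [Int.le_ceil R, abs_nonneg (n : ℝ)]
  exact ⟨abs_le.1 (by exact_mod_cast hn), abs_le.1 (by exact_mod_cast hk)⟩

/-! ### Poisson summation in the phase variable -/

theorem fourier_eq_integral_cexpChar (f : ℝ → ℂ) (t : ℝ) :
    𝓕 f t = ∫ x, f x * cexpChar (-(t * x)) := by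
  rw [Real.fourier_real_eq_integral_exp_smul]
  refine integral_congr_ae (Filter.Eventually.of_forall fun x => ?_)
  simp only [smul_eq_mul, cexpChar]
  rw [mul_comm]
  push_cast
  ring_nf

theorem fourier_fourier_apply (φ : 𝓢(ℝ, ℂ)) (t : ℝ) :
    ∫ x, (𝓕 φ) x * cexpChar (-(t * x)) = φ (-t) := by
  rw [← fourier_eq_integral_cexpChar, ← neg_neg t, ← Real.fourierInv_eq_fourier_neg, neg_neg,
    ← SchwartzMap.fourierInv_coe, FourierTransform.fourierInv_fourier_eq]

/-- Absolute summability of the coefficients permits termwise integration, and Fourier inversion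
evaluates each term. -/
theorem integral_fourier_mul_cexpChar_innerPhase (φ : 𝓢(ℝ, ℂ)) (n : ℤ) :
    ∫ x, (𝓕 φ) x * cexpChar (-(n * innerPhase x)) =
      ∑' k : ℤ, φ (-(n * √2 + k)) * phaseCoeff n k := by
  have hint : Integrable (fun x => (𝓕 φ) x) := (𝓕 φ).integrable
  have hF : ∀ k : ℤ, Integrable
      (fun x => (𝓕 φ) x * cexpChar (-((n * √2 + k) * x)) * phaseCoeff n k) := fun k =>
    (hint.mul_bdd (c := 1) (continuous_cexpChar.comp (by fun_prop)).aestronglyMeasurable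
      (Filter.Eventually.of_forall fun x => (norm_cexpChar _).le)).mul_const _
  have h := hasSum_integral_of_summable_integral_norm hF (by
    simp only [norm_mul, norm_cexpChar, mul_one, integral_mul_const]
    exact (summable_norm_phaseCoeff n).mul_left _)
  simp only [integral_mul_const, fourier_fourier_apply] at h
  rw [h.tsum_eq]
  refine integral_congr_ae (Filter.Eventually.of_forall fun x => ?_)
  simp only [cexpChar_neg_int_mul_innerPhase, ← tsum_mul_left]
  refine tsum_congr fun k => ?_
  ring

/-- The weight of the atom at `invPhase y`. -/
noncomputable def phaseWeight (y : ℝ) : ℝ := (innerPhaseDeriv (invPhase y))⁻¹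

theorem phaseWeight_pos (y : ℝ) : 0 < phaseWeight y := inv_pos.2 (innerPhaseDeriv_pos _)

theorem phaseWeight_le_one (y : ℝ) : phaseWeight y ≤ 1 := inv_le_one_of_one_le₀
  (innerPhaseDeriv_ge_one _)

theorem continuous_innerPhaseDeriv : Continuous innerPhaseDeriv := by
  unfold innerPhaseDeriv
  refine continuous_const.add (continuous_const.div (by fun_prop) fun x => ?_)
  linarith [Real.cos_le_one (2 * Real.pi * x)]

theorem continuous_phaseWeight : Continuous phaseWeight :=
  (continuous_innerPhaseDeriv.comp continuous_invPhase).inv₀ fun _ => (innerPhaseDeriv_pos _).ne'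

/-- Substitution `x = invPhase y`: the weight is exactly the Jacobian. -/
theorem fourier_comp_invPhase (f : ℝ → ℂ) (n : ℤ) :
    𝓕 (fun y => f (invPhase y) * (phaseWeight y : ℂ)) n =
      ∫ x, f x * cexpChar (-(n * innerPhase x)) := by
  have h := integral_image_eq_integral_abs_deriv_smul (f := invPhase) (f' := phaseWeight)
    MeasurableSet.univ (fun y _ => (hasDerivAt_invPhase y).hasDerivWithinAt)
    strictMono_invPhase.injective.injOn (fun x => f x * cexpChar (-(n * innerPhase x)))
  have hs : Function.Surjective invPhase := fun x => ⟨_, invPhase_innerPhase x⟩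
  rw [Set.image_univ, hs.range_eq] at h
  simp only [Measure.restrict_univ] at h
  rw [h, fourier_eq_integral_cexpChar]
  refine integral_congr_ae (Filter.Eventually.of_forall fun y => ?_)
  simp only [innerPhase_invPhase, abs_of_pos (phaseWeight_pos y), Complex.real_smul]
  ring

theorem tendsto_invPhase_cocompact :
    Filter.Tendsto invPhase (Filter.cocompact ℝ) (Filter.cocompact ℝ) :=
  innerPhaseHomeo.symm.isClosedEmbedding.tendsto_cocompact

theorem isBigO_comp_invPhase (φ : 𝓢(ℝ, ℂ)) :
    (fun y => φ (invPhase y) * (phaseWeight y : ℂ)) =O[Filter.cocompact ℝ]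
      fun y => |y| ^ (-2 : ℝ) := by
  have h1 : (fun y => φ (invPhase y) * (phaseWeight y : ℂ)) =O[Filter.cocompact ℝ]
      fun y => φ (invPhase y) := by
    refine Asymptotics.IsBigO.of_bound 1 (Filter.Eventually.of_forall fun y => ?_)
    rw [norm_mul, Complex.norm_real, Real.norm_of_nonneg (phaseWeight_pos y).le, mul_comm]
    gcongr
    exact phaseWeight_le_one y
  refine (h1.trans ((φ.isBigO_cocompact_rpow (-2)).comp_tendsto
    tendsto_invPhase_cocompact)).trans ?_
  have hlarge : ∀ᶠ y in Filter.cocompact ℝ, 2 ≤ |y| := 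
    (tendsto_norm_cocompact_atTop (E := ℝ)).eventually_ge_atTop 2
  -- For `|y| ≥ 2`, the bound `|y| ≤ 3 |invPhase y| + 1` gives `|invPhase y| ≥ |y| / 6`, and 36 is
  -- the square of 6.
  refine Asymptotics.IsBigO.of_bound 36 (hlarge.mono fun y hy => ?_)
  have hle := abs_le_abs_invPhase y
  have hpos : 0 < |y| := by linarith
  have hy6 : |y| / 6 ≤ |invPhase y| := by linarith
  simp only [Function.comp_apply, Real.norm_eq_abs]
  rw [abs_of_nonneg (a := |invPhase y| ^ (-2 : ℝ)) (by positivity),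
    abs_of_nonneg (a := |y| ^ (-2 : ℝ)) (by positivity)]
  calc |invPhase y| ^ (-2 : ℝ) ≤ (|y| / 6) ^ (-2 : ℝ) :=
        Real.rpow_le_rpow_of_nonpos (by positivity) hy6 (by norm_num)
    _ = 36 * |y| ^ (-2 : ℝ) := by
        rw [Real.div_rpow hpos.le (by norm_num), Real.rpow_neg (by norm_num : (0 : ℝ) ≤ 6)]
        norm_num
        ring

theorem fourier_coe_eq_cexpChar (n : ℤ) (x : ℝ) :
    fourier n (x : UnitAddCircle) = cexpChar (n * x) := by
  rw [fourier_coe_apply, cexpChar]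
  push_cast
  ring_nf

theorem finite_support_of_hasCompactSupport {φ : ℝ → ℂ} (hφ : HasCompactSupport φ) :
    {p : ℤ × ℤ | φ (-(p.1 * √2 + p.2)) * phaseCoeff p.1 p.2 ≠ 0}.Finite := by
  obtain ⟨R, hR⟩ := hφ.isCompact.isBounded.subset_closedBall 0
  refine (finite_int_prod_abs_le R).subset fun p hp => ?_
  have h1 := hR (subset_tsupport _ (left_ne_zero_of_mul hp))
  rw [mem_closedBall_zero_iff, norm_neg, Real.norm_eq_abs] at h1
  exact (abs_add_abs_le_of_phaseCoeff_ne_zero (right_ne_zero_of_mul hp)).trans h1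

theorem tsum_fourier_invPhase (φ : 𝓢(ℝ, ℂ)) (hφ : HasCompactSupport φ) (c : ℝ) :
    ∑' j : ℤ, (𝓕 φ) (invPhase (c + j)) * (phaseWeight (c + j) : ℂ) =
      ∑' p : ℤ × ℤ, φ (-(p.1 * √2 + p.2)) * (phaseCoeff p.1 p.2 * cexpChar (p.1 * c)) := by
  have hfin := finite_support_of_hasCompactSupport hφ
  have hsum : ∀ n : ℤ, 𝓕 (fun y => (𝓕 φ) (invPhase y) * (phaseWeight y : ℂ)) n =
      ∑' k : ℤ, φ (-(n * √2 + k)) * phaseCoeff n k := fun n =>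
    (fourier_comp_invPhase _ n).trans (integral_fourier_mul_cexpChar_innerPhase φ n)
  have hcont : Continuous (fun y => (𝓕 φ) (invPhase y) * (phaseWeight y : ℂ)) :=
    ((𝓕 φ).continuous.comp continuous_invPhase).mul
      (Complex.continuous_ofReal.comp continuous_phaseWeight)
  -- Compact support of `φ` leaves finitely many nonzero terms on the dual side, which settles its
  -- summability.
  rw [Real.tsum_eq_tsum_fourier_of_rpow_decay_of_summable hcont one_lt_two
    (isBigO_comp_invPhase (𝓕 φ)) ?_ c]
  · have hs : Summable fun p : ℤ × ℤ =>
        φ (-(p.1 * √2 + p.2)) * (phaseCoeff p.1 p.2 * cexpChar (p.1 * c)) := by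
      refine summable_of_hasFiniteSupport (hfin.subset fun p hp => ?_)
      rw [Function.mem_support, ← mul_assoc] at hp
      exact left_ne_zero_of_mul hp
    rw [hs.tsum_prod]
    refine tsum_congr fun n => ?_
    rw [hsum, fourier_coe_eq_cexpChar, ← tsum_mul_right]
    simp only [mul_assoc]
  · refine summable_of_hasFiniteSupport ((hfin.image Prod.fst).subset fun n hn => ?_)
    rw [Function.mem_support, hsum] at hn
    by_contra hn'
    refine hn ?_
    convert tsum_zero with k
    by_contra hk
    exact hn' ⟨(n, k), hk, rfl⟩

/-! ### Avoiding arithmetic progressions -/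

theorem irrational_sqrt_two_add_one : Irrational (√2 + 1) := by
  simpa using irrational_sqrt_two.add_natCast 1

/-- A continuous function with period `τ` which satisfies a mean value property with respect to two
shifts in opposite directions, both incommensurable with `τ`, is constant. -/
theorem eq_of_periodic_of_meanValue {g : ℝ → ℝ} (hg : Continuous g) {τ : ℝ} (hτ : Irrational τ)
    (hτ0 : 0 < τ) (hper : Function.Periodic g τ) {m n : ℕ} (hm : 0 < m) (hn : 0 < n)
    {p q K : ℝ} (hp : 0 < p) (hq : 0 < q)
    (h : ∀ y, (p + q) * g y = q * g (y - m) + p * g (y + n) + K) : ∀ y z, g y = g z := by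
  have hex : ∀ y, ∃ z ∈ Set.Icc 0 τ, g y = g z := fun y => by
    obtain ⟨z, hz, h⟩ := hper.exists_mem_Ico₀ hτ0 y
    exact ⟨z, Set.Ico_subset_Icc_self hz, h⟩
  have hne : (Set.Icc 0 τ).Nonempty := Set.nonempty_Icc.2 hτ0.le
  obtain ⟨y₁, -, h₁⟩ := isCompact_Icc.exists_isMaxOn hne hg.continuousOn
  obtain ⟨y₀, -, h₀⟩ := isCompact_Icc.exists_isMinOn hne hg.continuousOn
  have hmax : ∀ y, g y ≤ g y₁ := fun y => by
    obtain ⟨z, hz, h⟩ := hex y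
    exact h ▸ h₁ hz
  have hmin : ∀ y, g y₀ ≤ g y := fun y => by
    obtain ⟨z, hz, h⟩ := hex y
    exact h ▸ h₀ hz
  -- The relation at a minimum point gives `K ≤ 0`; at a maximum point this forces both shifted
  -- values to be maximal too.
  have hK : K ≤ 0 := by
    have := h y₀
    nlinarith [mul_le_mul_of_nonneg_left (hmin (y₀ - m)) hq.le,
      mul_le_mul_of_nonneg_left (hmin (y₀ + n)) hp.le]
  have hstep : ∀ y, g y = g y₁ → g (y - m) = g y₁ ∧ g (y + n) = g y₁ := fun y hy => by
    have := h y
    rw [hy] at this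
    have h1 := mul_le_mul_of_nonneg_left (hmax (y - m)) hq.le
    have h2 := mul_le_mul_of_nonneg_left (hmax (y + n)) hp.le
    exact ⟨le_antisymm (hmax _) (le_of_mul_le_mul_left (by linarith) hq),
      le_antisymm (hmax _) (le_of_mul_le_mul_left (by linarith) hp)⟩
  have hsub : ∀ (j : ℕ) y, g y = g y₁ → g (y - j * m) = g y₁ := fun j => by
    induction j with
    | zero => intro y hy; simpa using hy
    | succ j ih =>
      intro y hy
      have := (hstep _ (ih y hy)).1
      rw [← this]
      congr 1
      push_cast
      ring
  have hadd : ∀ (j : ℕ) y, g y = g y₁ → g (y + j * n) = g y₁ := fun j => by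
    induction j with
    | zero => intro y hy; simpa using hy
    | succ j ih =>
      intro y hy
      have := (hstep _ (ih y hy)).2
      rw [← this]
      congr 1
      push_cast
      ring
  let P : AddSubgroup ℝ :=
    { carrier := {t | ∀ y, g y = g y₁ → g (y + t) = g y₁ ∧ g (y - t) = g y₁}
      zero_mem' := fun y hy => by simpa using hy
      add_mem' := fun {a b} ha hb y hy => by
        refine ⟨?_, ?_⟩
        · rw [← add_assoc]
          exact (hb _ (ha y hy).1).1
        · rw [← sub_sub]
          exact (hb _ (ha y hy).2).2
      neg_mem' := fun {a} ha y hy => by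
        rw [sub_neg_eq_add, ← sub_eq_add_neg]
        exact (ha y hy).symm }
  -- The shifts `-m` and `+n` go one way each; iterating them yields both `+mn` and `-mn`, hence a
  -- group of translations, dense because `τ` is irrational.
  have hP : AddSubgroup.closure {τ, ((m * n : ℕ) : ℝ)} ≤ P := by
    rw [AddSubgroup.closure_le]
    rintro t (rfl | rfl) y hy
    · rw [hper y, hper.sub_eq y]
      exact ⟨hy, hy⟩
    · push_cast
      refine ⟨hadd m y hy, ?_⟩
      rw [mul_comm]
      exact hsub n y hy
  have hdense : Dense (AddSubgroup.closure {τ, ((m * n : ℕ) : ℝ)} : Set ℝ) :=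
    dense_addSubgroupClosure_pair_iff.2 (hτ.div_natCast (Nat.mul_pos hm hn).ne')
  have hconst : (fun t => g (y₁ + t)) = fun _ => g y₁ :=
    Continuous.ext_on hdense (by fun_prop) continuous_const fun t ht => (hP ht y₁ rfl).1
  have hall : ∀ y, g y = g y₁ := fun y => by
    have := congrFun hconst (y - y₁)
    simpa using this
  exact fun y z => (hall y).trans (hall z).symm

/-- An identity would pass to the periodic part `invPhase y - y / (√2 + 1)`, the linear part
contributing the constant `K`. That part would be constant, but its values at `innerPhase 0` and
`innerPhase (1/4)` differ. -/
theorem exists_invPhase_sub_ne (m n : ℕ) (hm : 0 < m) (hn : 0 < n) {p q : ℝ} (hp : 0 < p)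
    (hq : 0 < q) :
    ∃ y, q * invPhase (y - m) + p * invPhase (y + n) - (p + q) * invPhase y ≠ 0 := by
  by_contra! h
  have hτ0 : 0 < √2 + 1 := by positivity
  have hg := eq_of_periodic_of_meanValue (g := fun y => invPhase y - y / (√2 + 1))
    (continuous_invPhase.sub (by fun_prop)) irrational_sqrt_two_add_one hτ0
    (fun y => by
      simp only [invPhase_add]
      field_simp
      ring) hm hn hp hq (K := (p * n - q * m) / (√2 + 1)) (fun y => by
      have := h y
      field_simp
      linear_combination (-(√2 + 1)) * this)
  have h0 : innerPhase 0 = 0 := by simp [innerPhase]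
  have h4 : innerPhase (1 / 4) = (√2 + 1) * (1 / 4) + Real.arctan (1 / 2) / Real.pi := by
    have : 2 * Real.pi * (1 / 4) = Real.pi / 2 := by ring
    rw [innerPhase, this, Real.sin_pi_div_two, Real.cos_pi_div_two, sub_zero]
  have := hg (innerPhase 0) (innerPhase (1 / 4))
  simp only [invPhase_innerPhase] at this
  rw [h0, h4] at this
  have hpos : 0 < Real.arctan (1 / 2) := by
    rw [← Real.arctan_zero]
    exact Real.arctan_strictMono (by norm_num)
  have hne : Real.arctan (1 / 2) / Real.pi / (√2 + 1) = 0 := by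
    rw [add_div, mul_div_cancel_left₀ _ hτ0.ne', zero_div] at this
    linarith
  have : 0 < Real.arctan (1 / 2) / Real.pi / (√2 + 1) := by
    have := Real.pi_pos
    positivity
  linarith

/-- Zeros of a nontrivial analytic function on the line are isolated, and a discrete subset of a
hereditarily Lindelöf space is countable. -/
theorem countable_zeros_of_contDiff {f : ℝ → ℝ} (hf : ContDiff ℝ ⊤ f) {y : ℝ} (hy : f y ≠ 0) :
    {x | f x = 0}.Countable := by
  have h := hf.analyticOnNhd.preimage_zero_mem_codiscrete hy
  have hd : IsDiscrete (f ⁻¹' {0} ∩ Set.univ) := isDiscrete_of_codiscreteWithin h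
  rw [Set.inter_univ] at hd
  exact (HereditarilyLindelofSpace.isLindelof _).countable_of_isDiscrete hd

/-- For a suitable shift `c`, no three points of the set `invPhase (c + ℤ)` have a rational ratio of
differences. -/
theorem exists_generic_shift : ∃ c : ℝ, ∀ (j : ℤ) (m n p q : ℕ), 0 < m → 0 < n → 0 < p → 0 < q →
    q * invPhase (c + j - m) + p * invPhase (c + j + n) - (p + q) * invPhase (c + j) ≠ 0 := by
  let f : ℤ × ℕ × ℕ × ℕ × ℕ → ℝ → ℝ := fun t c =>
    (t.2.2.2.2 + 1 : ℕ) * invPhase (c + t.1 - (t.2.1 + 1 : ℕ)) +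
      (t.2.2.2.1 + 1 : ℕ) * invPhase (c + t.1 + (t.2.2.1 + 1 : ℕ)) -
      ((t.2.2.2.1 + 1 : ℕ) + (t.2.2.2.2 + 1 : ℕ)) * invPhase (c + t.1)
  have hf : ∀ t, {c | f t c = 0}.Countable := fun t => by
    have hc : ∀ a : ℝ, ContDiff ℝ ⊤ fun c : ℝ => invPhase (c + a) := fun a =>
      contDiff_invPhase.comp (contDiff_id.add contDiff_const)
    obtain ⟨y, hy⟩ := exists_invPhase_sub_ne (t.2.1 + 1) (t.2.2.1 + 1) (Nat.succ_pos _)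
      (Nat.succ_pos _) (p := (t.2.2.2.1 + 1 : ℕ)) (q := (t.2.2.2.2 + 1 : ℕ))
      (by positivity) (by positivity)
    refine countable_zeros_of_contDiff (y := y - t.1) ?_ (by simpa only [f, sub_add_cancel])
    simp only [f, add_sub_assoc, add_assoc (_ : ℝ) (t.1 : ℝ)]
    simp only [← add_sub_assoc (_ * _ : ℝ)]
    exact ((contDiff_const.mul (hc _)).add (contDiff_const.mul (hc _))).sub
      (contDiff_const.mul (hc _))
  have hU : (⋃ t, {c | f t c = 0}).Countable := Set.countable_iUnion hf
  obtain ⟨c, hc⟩ : (⋃ t, {c | f t c = 0})ᶜ.Nonempty := by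
    by_contra hne
    rw [Set.not_nonempty_iff_eq_empty, Set.compl_empty_iff] at hne
    exact not_countable (α := ℝ) (Set.countable_univ_iff.1 (hne ▸ hU))
  refine ⟨c, fun j m n p q hm hn hp hq h => hc (Set.mem_iUnion.2
    ⟨(j, m - 1, n - 1, p - 1, q - 1), ?_⟩)⟩
  simp only [f, Set.mem_ofPred_eq, Nat.sub_add_cancel hm, Nat.sub_add_cancel hn,
    Nat.sub_add_cancel hp, Nat.sub_add_cancel hq]
  exact h

theorem exists_three_of_infinite {α : Type*} [LinearOrder α] {s : Set α} (hs : s.Infinite) :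
    ∃ x ∈ s, ∃ y ∈ s, ∃ z ∈ s, x < y ∧ y < z := by
  obtain ⟨t, hts, ht⟩ := hs.exists_subset_card_eq 3
  let e := t.orderEmbOfFin ht
  have he : ∀ i, e i ∈ s := fun i => hts (t.orderEmbOfFin_mem ht i)
  exact ⟨e 0, he 0, e 1, he 1, e 2, he 2, e.strictMono (by decide), e.strictMono (by decide)⟩

theorem finite_range_inter_arithProg {c : ℝ}
    (hc : ∀ (j : ℤ) (m n p q : ℕ), 0 < m → 0 < n → 0 < p → 0 < q →
      q * invPhase (c + j - m) + p * invPhase (c + j + n) - (p + q) * invPhase (c + j) ≠ 0)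
    (a d : ℝ) : (Set.range (fun j : ℤ => invPhase (c + j)) ∩ arithProg a d).Finite := by
  by_contra hinf
  obtain ⟨_, ⟨⟨i, rfl⟩, r, hr⟩, _, ⟨⟨j, rfl⟩, s, hs⟩, _, ⟨⟨k, rfl⟩, t, ht⟩, hij, hjk⟩ :=
    exists_three_of_infinite hinf
  simp only at hr hs ht hij hjk
  have hij' : i < j := by
    have := strictMono_invPhase.lt_iff_lt.1 hij
    exact_mod_cast (add_lt_add_iff_left c).1 this
  have hjk' : j < k := by
    have := strictMono_invPhase.lt_iff_lt.1 hjk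
    exact_mod_cast (add_lt_add_iff_left c).1 this
  have h1 : 0 < ((s : ℝ) - r) * d := by linarith
  have h2 : 0 < ((t : ℝ) - s) * d := by linarith
  have hsr : s - r ≠ 0 := fun h => by
    have : (s : ℝ) - r = 0 := by exact_mod_cast h
    simp [this] at h1
  have hts : t - s ≠ 0 := fun h => by
    have : (t : ℝ) - s = 0 := by exact_mod_cast h
    simp [this] at h2
  obtain ⟨m, hm⟩ := Int.eq_ofNat_of_zero_le (sub_pos.2 hij').le
  obtain ⟨n, hn⟩ := Int.eq_ofNat_of_zero_le (sub_pos.2 hjk').le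
  -- Consecutive differences of the three points are `(s - r) d` and `(t - s) d`, so
  -- cross-multiplication gives the excluded relation; absolute values cover `d < 0`.
  refine hc j m n (s - r).natAbs (t - s).natAbs (by omega) (by omega)
    (Int.natAbs_pos.2 hsr) (Int.natAbs_pos.2 hts) ?_
  have e1 : c + j - m = c + i := by
    have : (j : ℝ) - i = m := by exact_mod_cast hm
    linarith
  have e2 : c + j + n = c + k := by
    have : (k : ℝ) - j = n := by exact_mod_cast hn
    linarith
  rw [e1, e2, Nat.cast_natAbs, Nat.cast_natAbs, ← hr, ← hs, ← ht]
  push_cast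
  rcases lt_trichotomy d 0 with hd | hd | hd
  · rw [abs_of_neg (neg_of_mul_pos_left h1 hd.le), abs_of_neg (neg_of_mul_pos_left h2 hd.le)]
    ring
  · simp [hd] at h1
  · rw [abs_of_pos (pos_of_mul_pos_left h1 hd.le), abs_of_pos (pos_of_mul_pos_left h2 hd.le)]
    ring

/-! ### The measure and its Fourier transform -/

theorem summable_one_add_abs_invPhase (c : ℝ) :
    Summable fun j : ℤ => (1 + |invPhase (c + j)|) ^ (-(2 : ℝ)) := by
  refine summable_of_isBigO (Real.summable_abs_int_rpow one_lt_two) ?_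
  refine Asymptotics.IsBigO.of_bound ((3 * (|c| + 1)) ^ (-(2 : ℝ)))⁻¹
    ((Filter.eventually_cofinite_ne 0).mono fun j hj => ?_)
  have hj0 : 0 < |(j : ℝ)| := abs_pos.2 (by exact_mod_cast hj)
  have hA : 0 < 3 * (|c| + 1) := by positivity
  have hle : |(j : ℝ)| ≤ (1 + |invPhase (c + j)|) * (3 * (|c| + 1)) := by
    have h1 := abs_le_abs_invPhase (c + j)
    have h2 : |(j : ℝ)| ≤ |c + j| + |c| := by
      simpa using abs_sub (c + j) c
    nlinarith [mul_nonneg (abs_nonneg (invPhase (c + j))) (abs_nonneg c), abs_nonneg c]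
  rw [Real.norm_of_nonneg (by positivity), Real.norm_of_nonneg (by positivity), mul_comm,
    ← div_eq_mul_inv, ← Real.div_rpow hj0.le hA.le]
  exact Real.rpow_le_rpow_of_nonpos (by positivity) ((div_le_iff₀ hA).2 hle) (by norm_num)

theorem injective_invPhase_add_int (c : ℝ) :
    Function.Injective fun j : ℤ => invPhase (c + j) := fun i j h => by
  have := strictMono_invPhase.injective h
  exact_mod_cast add_left_cancel this

theorem finite_invPhase_add_int_mem_Icc (c a b : ℝ) :
    {j : ℤ | (phaseWeight (c + j) : ℂ) ≠ 0 ∧ invPhase (c + j) ∈ Set.Icc a b}.Finite := by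
  refine (Set.finite_Icc ⌊innerPhase a - c⌋ ⌈innerPhase b - c⌉).subset ?_
  rintro j ⟨-, h1, h2⟩
  have h1' := strictMono_innerPhase.monotone h1
  have h2' := strictMono_innerPhase.monotone h2
  rw [innerPhase_invPhase] at h1' h2'
  constructor
  · exact_mod_cast (Int.floor_le _).trans (by linarith : innerPhase a - c ≤ j)
  · exact_mod_cast (by linarith : (j : ℝ) ≤ innerPhase b - c).trans (Int.le_ceil _)

/-- The measure `∑ j, phaseWeight (c + j) • δ_{invPhase (c + j)}`. -/
noncomputable def combMeasure (c : ℝ) : LocFinComplexMeasure :=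
  LocFinComplexMeasure.ofAtoms (fun j : ℤ => invPhase (c + j))
    (fun j => (phaseWeight (c + j) : ℂ)) (finite_invPhase_add_int_mem_Icc c)

/-- Irrationality of `√2` prevents two index pairs from giving the same frequency, so coefficients
never merge or cancel. -/
theorem injective_spectrum : Function.Injective fun p : ℤ × ℤ => -(p.1 * √2 + p.2) := by
  rintro ⟨n, k⟩ ⟨n', k'⟩ h
  have h' : ((n - n' : ℤ) : ℝ) * √2 = (k' - k : ℤ) := by
    push_cast
    linear_combination -h
  have hn : n - n' = 0 := by
    by_contra hne
    exact (irrational_sqrt_two.intCast_mul hne).ne_int _ h'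
  rw [hn, Int.cast_zero, zero_mul] at h'
  have hk : k' - k = 0 := by exact_mod_cast h'.symm
  exact Prod.ext (by simp only; omega) (by simp only; omega)

theorem finite_spectrum_mem_Icc (c a b : ℝ) :
    {p : ℤ × ℤ | phaseCoeff p.1 p.2 * cexpChar (p.1 * c) ≠ 0 ∧
      -(p.1 * √2 + p.2) ∈ Set.Icc a b}.Finite := by
  refine (finite_int_prod_abs_le (max |a| |b|)).subset ?_
  rintro p ⟨hp, h⟩
  refine (abs_add_abs_le_of_phaseCoeff_ne_zero (left_ne_zero_of_mul hp)).trans ?_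
  rw [← abs_neg]
  exact abs_le_max_abs_abs h.1 h.2

/-- The Fourier transform of `combMeasure c`. -/
noncomputable def combSpectrum (c : ℝ) : LocFinComplexMeasure :=
  LocFinComplexMeasure.ofAtoms (fun p : ℤ × ℤ => -(p.1 * √2 + p.2))
    (fun p => phaseCoeff p.1 p.2 * cexpChar (p.1 * c)) (finite_spectrum_mem_Icc c)

/-- All weights are positive, so the measure equals its variation and the distribution `T` can be
read off the latter. -/
theorem phase_combMeasure (c x : ℝ) : (combMeasure c).phase x = 1 := by
  change LocFinComplexMeasure.atomsPhase (fun j : ℤ => invPhase (c + j))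
    (fun j => (phaseWeight (c + j) : ℂ)) x = 1
  by_cases hx : x ∈ Set.range fun j : ℤ => invPhase (c + j)
  · obtain ⟨j, rfl⟩ := hx
    have h := phaseWeight_pos (c + j)
    rw [LocFinComplexMeasure.atomsPhase, (injective_invPhase_add_int c).extend_apply]
    have h0 : (phaseWeight (c + j) : ℂ) ≠ 0 := by exact_mod_cast h.ne'
    rw [if_neg h0, Complex.norm_real, Real.norm_of_nonneg h.le, div_self h0]
  · rw [LocFinComplexMeasure.atomsPhase, Function.extend_apply' _ _ _ hx]
    rfl

theorem atoms_combMeasure (c : ℝ) :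
    (combMeasure c).atoms = Set.range fun j : ℤ => invPhase (c + j) := by
  rw [combMeasure, LocFinComplexMeasure.atoms_ofAtoms (injective_invPhase_add_int c),
    ← Set.image_univ]
  congr 1
  ext j
  simpa using (phaseWeight_pos (c + j)).ne'

/-- The weights are at most 1 and the atoms grow linearly in the index, so exponent 2 suffices. -/
instance hasTemperateGrowth_combMeasure (c : ℝ) : (combMeasure c).variation.HasTemperateGrowth := by
  refine ⟨2, ?_⟩
  change Integrable _ (Measure.sum _)
  rw [integrable_sum_measure_iff]
  refine ⟨fun j => ?_, ?_⟩
  · exact (integrable_dirac (by simp)).smul_measure ENNReal.ofReal_ne_top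
  · simp only [integral_smul_measure, integral_dirac]
    refine (summable_one_add_abs_invPhase c).of_nonneg_of_le (fun j => by positivity) fun j => ?_
    rw [ENNReal.toReal_ofReal (norm_nonneg _), Complex.norm_real,
      Real.norm_of_nonneg (phaseWeight_pos _).le, smul_eq_mul, Real.norm_of_nonneg (by positivity)]
    exact mul_le_of_le_one_left (by positivity) (phaseWeight_le_one _)

theorem integral_combMeasure_eq (c : ℝ) (f : ℝ → ℂ) :
    (combMeasure c).integral f = ∫ x, f x ∂(combMeasure c).variation := by
  simp [LocFinComplexMeasure.integral, phase_combMeasure]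

theorem isReal_combMeasure (c : ℝ) : (combMeasure c).IsReal := by
  intro E _ _
  simp only [LocFinComplexMeasure.value, phase_combMeasure]
  simp

theorem variation_combMeasure_ne_zero (c : ℝ) : (combMeasure c).variation ≠ 0 := by
  intro h
  have h' := LocFinComplexMeasure.variation_singleton_ofAtoms (injective_invPhase_add_int c)
    (finite_invPhase_add_int_mem_Icc c) 0
  change (combMeasure c).variation _ = _ at h'
  rw [h, Measure.coe_zero, Pi.zero_apply, eq_comm, ENNReal.ofReal_eq_zero, norm_le_zero_iff] at h'
  exact (phaseWeight_pos _).ne' (by exact_mod_cast h')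

theorem isDistribution_combSpectrum (c : ℝ) :
    (combSpectrum c).IsDistribution (𝓕 (combMeasure c).variation.toTemperedDistribution) := by
  intro φ hφ
  rw [TemperedDistribution.fourier_apply, Measure.toTemperedDistribution_apply (combMeasure c).variation,
    ← integral_combMeasure_eq]
  rw [combMeasure, LocFinComplexMeasure.integral_ofAtoms_of_integrable
    (injective_invPhase_add_int c) _ (SchwartzMap.integrable (μ := (combMeasure c).variation) _),
    combSpectrum, LocFinComplexMeasure.integral_ofAtoms injective_spectrum _ φ.continuous hφ]
  exact tsum_fourier_invPhase φ hφ c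

theorem theorem1 :
    ∃ (μ ν : LocFinComplexMeasure) (T : 𝓢'(ℝ, ℂ)),
      μ.variation ≠ 0 ∧ μ.IsReal ∧
      μ.IsPurePoint ∧ μ.IsDistribution T ∧
      ν.IsPurePoint ∧ ν.IsDistribution (𝓕 T) ∧
      IsDiscreteClosed μ.atoms ∧ IsDiscreteClosed ν.atoms ∧
      (∀ a d : ℝ, (μ.atoms ∩ arithProg a d).Finite) ∧
      (∀ (d : ℝ) (F : Finset ℝ), ¬ μ.atoms ⊆ ⋃ a ∈ F, arithProg a d) := by
  obtain ⟨c, hc⟩ := exists_generic_shift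
  have hfin : ∀ a d : ℝ, ((combMeasure c).atoms ∩ arithProg a d).Finite := fun a d => by
    rw [atoms_combMeasure]
    exact finite_range_inter_arithProg hc a d
  refine ⟨combMeasure c, combSpectrum c, (combMeasure c).variation.toTemperedDistribution,
    variation_combMeasure_ne_zero c, isReal_combMeasure c,
    LocFinComplexMeasure.isPurePoint_ofAtoms (injective_invPhase_add_int c) _, fun f _ => ?_,
    LocFinComplexMeasure.isPurePoint_ofAtoms injective_spectrum _, isDistribution_combSpectrum c,
    LocFinComplexMeasure.isDiscreteClosed_atoms_ofAtoms (injective_invPhase_add_int c) _,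
    LocFinComplexMeasure.isDiscreteClosed_atoms_ofAtoms injective_spectrum _, hfin,
    fun d F hsub => ?_⟩
  · rw [Measure.toTemperedDistribution_apply (combMeasure c).variation, integral_combMeasure_eq]
  · have hinf : (combMeasure c).atoms.Infinite := by
      rw [atoms_combMeasure]
      exact Set.infinite_range_of_injective (injective_invPhase_add_int c)
    refine hinf ((F.finite_toSet.biUnion fun a _ => hfin a d).subset fun x hx => ?_)
    obtain ⟨a, ha, hxa⟩ := Set.mem_iUnion₂.1 (hsub hx)
    exact Set.mem_iUnion₂.2 ⟨a, ha, hx, hxa⟩
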